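/- Let $\mathcal X$ be a set, let $n,n'\ge 1$ be integers, $k\in\mathbb N$, $\alpha>0$, $\varepsilon>0$ and $\xi,\rho\in\mathbb R$. Let $\|\cdot\|$ be a norm on $\mathbb R^k$ and let $q:\mathcal X\to\mathbb R^k$ satisfy $\|q(z)\|\le 1$ for all $z\in\mathcal X$. For a dataset $x=(x_1,\dots,x_m)\in\mathcal X^m$ with $m\geq 1$ write $q(x)=\frac1m\sum_{i=1}^m q(x_i)$. A mechanism $M:\mathcal X^m\to\mathbb R^k$ assigns to each $x\in\mathcal X^m$ a random variable $M(x)$, that is, a Borel probability distribution on $\mathbb R^k$. It is $(\xi,\rho)$-zCDP if, for all $x,x'\in\mathcal X^m$ differing in a single entry and all $a\in(1,\infty)$, $D_a(M(x)\,\|\,M(x'))\le \xi+\rho a$, where $D_a(P\|Q)=\frac1{a-1}\log\int\left(\frac{dP}{dQ}\right)^a dQ$ if $P\ll Q$ and $D_a(P\|Q)=\infty$ otherwise. It is $(\varepsilon,0)$-differentially private if $\Pr[M(x)\in S]\le e^{\varepsilon}\Pr[M(x')\in S]$ for all such $x,x'$ and all measurable $S\subseteq\mathbb R^k$. All logarithms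 are natural. Suppose there exists a $(\xi,\rho)$-zCDP mechanism $M:\mathcal X^n\to\mathbb R^k$ such that $\mathbb E\,\|M(x)-q(x)\|\le\alpha$ for all $x\in\mathcal X^n$. Assume $\xi\le\alpha^2$, $\rho\le\alpha^2$ and $$n'\ \ge\ \frac{4}{\varepsilon\alpha}\Bigl(\rho n^2+\xi n(1+\log n)+1\Bigr).$$ Then there exists an $(\varepsilon,0)$-differentially private mechanism $M':\mathcal X^{n'}\to\mathbb R^k$ such that, for all $x\in\mathcal X^{n'}$ and all $\beta>0$, $$\mathbb E\,\|M'(x)-q(x)\|\le 10\alpha\qquad\text{and}\qquad \Pr\Bigl[\|M'(x)-q(x)\|>10\alpha+\frac{4}{\varepsilon n'}\log\frac1\beta\Bigr]\le\beta.$$ -/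

import Mathlib

open MeasureTheory
open scoped ENNReal

/-- A randomised mechanism on datasets of `n` rows from the data universe `X`, given by the law of
its output on each dataset. -/
abbrev Mechanism (X : Type*) (n : ℕ) (Y : Type*) [MeasurableSpace Y] :=
  (Fin n → X) → ProbabilityMeasure Y

/-- Two datasets differ in a single entry. -/
def Neighbouring {X : Type*} {n : ℕ} (x x' : Fin n → X) : Prop :=
  ∃ i, x i ≠ x' i ∧ ∀ j, j ≠ i → x j = x' j

open Classical in
/-- Rényi divergence of order `a ∈ (1, ∞)` between probability measures:
`(a - 1)⁻¹ log 𝔼_{Q} [(dP/dQ)^a]` if `P ≪ Q`, and `∞` otherwise. It takes values in the extended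
reals, so it is also `∞` when the expectation is infinite. -/
noncomputable def renyiDiv {Y : Type*} [MeasurableSpace Y] (a : ℝ) (P Q : Measure Y) : EReal :=
  if P ≪ Q then (((a - 1)⁻¹ : ℝ) : EReal) * ENNReal.log (∫⁻ y, (P.rnDeriv Q y) ^ a ∂Q) else ⊤

/-- `(ξ, ρ)`-zero-concentrated differential privacy. -/
def IsZCDP {X : Type*} {n : ℕ} {Y : Type*} [MeasurableSpace Y] (ξ ρ : ℝ) (M : Mechanism X n Y) :
    Prop :=
  ∀ x x' : Fin n → X, Neighbouring x x' → ∀ a : ℝ, 1 < a →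
    renyiDiv a (M x : Measure Y) (M x' : Measure Y) ≤ ((ξ + ρ * a : ℝ) : EReal)

/-- `(ε, δ)`-differential privacy. -/
def IsDP {X : Type*} {n : ℕ} {Y : Type*} [MeasurableSpace Y] (ε δ : ℝ) (M : Mechanism X n Y) :
    Prop :=
  ∀ x x' : Fin n → X, Neighbouring x x' → ∀ S : Set Y, MeasurableSet S →
    (M x : Measure Y).real S ≤ Real.exp ε * (M x' : Measure Y).real S + δ

/-- The value of the statistical queries `q` on a dataset: the average of `q` over its rows. -/
noncomputable def statQuery {X : Type*} {k : ℕ} (q : X → Fin k → ℝ) {n : ℕ} (x : Fin n → X) :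
    Fin k → ℝ :=
  (n : ℝ)⁻¹ • ∑ i, q (x i)

/-- The expected error `𝔼 ‖M(x) - q(x)‖` (possibly infinite), the norm being `N`. -/
noncomputable def expectedError {X : Type*} {k n : ℕ} (N : Seminorm ℝ (Fin k → ℝ))
    (q : X → Fin k → ℝ) (M : Mechanism X n (Fin k → ℝ)) (x : Fin n → X) : ℝ≥0∞ :=
  ∫⁻ y, ENNReal.ofReal (N (y - statQuery q x)) ∂(M x : Measure (Fin k → ℝ))

/-!
An accurate concentrated-private mechanism `M` on `n` rows forces the set of achievable query
values to be small, and the exponential mechanism over a net of that set is then accurate and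
purely private on `n'` rows.

*Packing.* Group privacy bounds the Kullback-Leibler divergence between the outputs of `M` on any
two datasets by `n * (ρ * n + ξ * harmonic n)`. It is proved in its dual, Donsker-Varadhan form
for indicators: Hölder's inequality along a chain of neighbouring datasets controls
`l * P A - log 𝔼_Q exp (l * 1_A)` (`mul_measureReal_le_of_chain`). Datasets with `4 * α`-separated
query values have disjoint balls which the outputs of `M` hit with probability `1 / 2`; comparing
with a fixed output law bounds the logarithm of their number (`IsZCDP.log_card_le`). A maximal
packing is therefore a finite `4 * α`-net (`IsZCDP.exists_net`).

*Generalization.* The query values of a dataset of size `n'` are close to those of one of its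
subsamples of size `n`: `M` run on a random subsample `s` is close both to `q s` by accuracy and,
since its output hardly depends on any single row of `s`, to the population value
(`IsZCDP.exists_subsample`). Stability enters through the Rényi divergence of order `2`, applied
to a measurable choice of norming functionals for the error.

*Selection.* The exponential mechanism at inverse temperature `ε * n' / 4` over the net is
`(ε, 0)`-private and loses the logarithm of the size of the net, divided by the inverse temperature
(`exists_isDP_of_net`). The net error is at most `8 * α` and the entropy loss at most `2 * α`.

The parameter `ξ` may be negative. Then `ξ * harmonic n` can exceed `ξ * (1 + log n)`, and the
entropy loss is only bounded by `5 / 2 * α` (`group_privacy_le_of_neg`); but the generalization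
error is smaller in this case, and the net error is at most `15 / 2 * α`. Both estimates use
`α ≤ 1 / 10`, which is no restriction because otherwise the constant answer `0` is accurate enough.
-/

/-! ### Rényi moment bounds and group privacy -/

/-- `P` is absolutely continuous with respect to `Q` and, for every order `a > 1`, the Rényi
divergence of `P` from `Q` is at most `ξ + ρ * a`. The bound is stated for the moments
`𝔼_Q [(dP/dQ)^a]`, so that it does not involve logarithms of possibly infinite quantities. -/
def HasRenyiBound {Y : Type*} [MeasurableSpace Y] (ξ ρ : ℝ) (P Q : Measure Y) : Prop :=
  P ≪ Q ∧ ∀ a : ℝ, 1 < a →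
    ∫⁻ y, (P.rnDeriv Q y) ^ a ∂Q ≤ ENNReal.ofReal (Real.exp ((a - 1) * (ξ + ρ * a)))

theorem hasRenyiBound_of_renyiDiv_le {Y : Type*} [MeasurableSpace Y] {ξ ρ : ℝ} {P Q : Measure Y}
    (h : ∀ a : ℝ, 1 < a → renyiDiv a P Q ≤ ((ξ + ρ * a : ℝ) : EReal)) :
    HasRenyiBound ξ ρ P Q := by
  have hac : P ≪ Q := by
    by_contra hn
    have := h 2 (by norm_num)
    rw [renyiDiv, if_neg hn, top_le_iff] at this
    exact EReal.coe_ne_top _ this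
  refine ⟨hac, fun a ha => ?_⟩
  have h1 := h a ha
  rw [renyiDiv, if_pos hac] at h1
  have hpos : 0 < a - 1 := sub_pos.2 ha
  have h2 := mul_le_mul_of_nonneg_left h1 (a := ((a - 1 : ℝ) : EReal))
    (by exact_mod_cast hpos.le)
  rw [← mul_assoc, ← EReal.coe_mul, ← EReal.coe_mul, mul_inv_cancel₀ hpos.ne', EReal.coe_one,
    one_mul] at h2
  have h3 := EReal.exp_monotone h2
  rwa [ENNReal.exp_log, EReal.exp_coe] at h3

theorem HasRenyiBound.refl {Y : Type*} [MeasurableSpace Y] {ξ ρ : ℝ} (P : Measure Y)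
    [IsProbabilityMeasure P] (h : ∀ a : ℝ, 1 < a → 0 ≤ ξ + ρ * a) : HasRenyiBound ξ ρ P P := by
  refine ⟨Measure.AbsolutelyContinuous.rfl, fun a ha => ?_⟩
  have : ∫⁻ y, (P.rnDeriv P y) ^ a ∂P = 1 := by
    rw [lintegral_congr_ae (g := fun _ => 1)]
    · simp
    · filter_upwards [P.rnDeriv_self] with y hy
      simp [hy]
  rw [this, ← ENNReal.ofReal_one]
  apply ENNReal.ofReal_le_ofReal
  rw [Real.one_le_exp_iff]
  exact mul_nonneg (by linarith) (h a ha)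

/-- Hölder's inequality with the density `dP/dQ`, at the conjugate exponents `1 / θ` and
`1 / (1 - θ)`. -/
theorem HasRenyiBound.lintegral_le {Y : Type*} [MeasurableSpace Y] {ξ ρ : ℝ} {P Q : Measure Y}
    [IsProbabilityMeasure P] [IsProbabilityMeasure Q]
    (h : HasRenyiBound ξ ρ P Q) {θ : ℝ} (h0 : 0 < θ) (h1 : θ < 1) {f : Y → ℝ≥0∞}
    (hf : Measurable f) :
    ∫⁻ y, f y ∂P ≤ (∫⁻ y, f y ^ (1 / θ) ∂Q) ^ θ *
      ENNReal.ofReal (Real.exp (θ * (ξ + ρ / (1 - θ)))) := by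
  have hθ : 0 < 1 - θ := by linarith
  have hconj : (1 / (1 - θ)).HolderConjugate (1 / θ) := by
    rw [Real.holderConjugate_iff]
    refine ⟨by rw [lt_div_iff₀ hθ]; linarith, by simp⟩
  have hH := ENNReal.lintegral_mul_le_Lp_mul_Lq Q hconj
    (P.measurable_rnDeriv Q).aemeasurable hf.aemeasurable
  simp only [Pi.mul_apply, one_div_one_div] at hH
  rw [lintegral_rnDeriv_mul h.1 hf.aemeasurable, mul_comm] at hH
  refine hH.trans ?_
  gcongr
  have hm := h.2 (1 / (1 - θ)) (by rw [lt_div_iff₀ hθ]; linarith)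
  calc _ ≤ (ENNReal.ofReal (Real.exp ((1 / (1 - θ) - 1) * (ξ + ρ * (1 / (1 - θ)))))) ^ (1 - θ) := by
        gcongr
    _ = _ := by
        rw [ENNReal.ofReal_rpow_of_pos (Real.exp_pos _), ← Real.exp_mul]
        congr 2
        field_simp
        ring

theorem HasRenyiBound.nonneg {Y : Type*} [MeasurableSpace Y] {ξ ρ : ℝ} {P Q : Measure Y}
    [IsProbabilityMeasure P] [IsProbabilityMeasure Q]
    (h : HasRenyiBound ξ ρ P Q) {a : ℝ} (ha : 1 < a) : 0 ≤ ξ + ρ * a := by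
  have hpos : 0 < a := by linarith
  have hθ : 0 < 1 - 1 / a := by
    rw [sub_pos, div_lt_one hpos]; exact ha
  have h1 := h.lintegral_le hθ (by simpa using hpos) (f := fun _ => 1) measurable_const
  simp only [ENNReal.one_rpow, lintegral_const, measure_univ, mul_one, one_mul, sub_sub_cancel,
    div_div_eq_mul_div, div_one] at h1
  rw [ENNReal.one_le_ofReal, Real.one_le_exp_iff] at h1
  exact nonneg_of_mul_nonneg_right h1 hθ

/-- The logarithmic moment generating function, at `l`, of the indicator of the event `A` under
`P`. -/
noncomputable def logMomentIndicator {Y : Type*} [MeasurableSpace Y] (P : Measure Y) (A : Set Y)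
    (l : ℝ) : ℝ :=
  Real.log (1 + (Real.exp l - 1) * P.real A)

theorem one_add_exp_sub_one_mul_pos {p : ℝ} (h0 : 0 ≤ p) (h1 : p ≤ 1) (l : ℝ) :
    0 < 1 + (Real.exp l - 1) * p := by
  nlinarith [Real.exp_pos l, mul_nonneg (Real.exp_pos l).le h0,
    mul_nonneg (Real.exp_pos l).le (sub_nonneg.2 h1)]

theorem lintegral_exp_indicator {Y : Type*} [MeasurableSpace Y] (P : Measure Y)
    [IsProbabilityMeasure P] {A : Set Y} (hA : MeasurableSet A) (l : ℝ) :
    ∫⁻ y, ENNReal.ofReal (Real.exp (A.indicator (fun _ => l) y)) ∂P =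
      ENNReal.ofReal (1 + (Real.exp l - 1) * P.real A) := by
  have h1 : ∫⁻ y, ENNReal.ofReal (Real.exp (A.indicator (fun _ => l) y)) ∂P =
      ENNReal.ofReal (Real.exp l) * P A + P Aᶜ := by
    rw [← lintegral_add_compl _ hA]
    congr 1
    · rw [setLIntegral_congr_fun hA (g := fun _ => ENNReal.ofReal (Real.exp l))]
      · simp
      · intro y hy; simp [hy]
    · rw [setLIntegral_congr_fun hA.compl (g := fun _ => 1)]
      · simp
      · intro y hy; simp [Set.indicator_of_notMem hy]
  rw [h1, ← ofReal_measureReal (μ := P) (s := A), ← ofReal_measureReal (μ := P) (s := Aᶜ),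
    ← ENNReal.ofReal_mul (Real.exp_pos _).le,
    ← ENNReal.ofReal_add (by positivity) measureReal_nonneg, probReal_compl_eq_one_sub hA]
  congr 1
  ring

/-- Jensen's inequality for the indicator of an event. -/
theorem mul_measureReal_le_logMomentIndicator {Y : Type*} [MeasurableSpace Y] (P : Measure Y)
    [IsProbabilityMeasure P] (A : Set Y) (l : ℝ) :
    l * P.real A ≤ logMomentIndicator P A l := by
  have h0 : 0 ≤ P.real A := measureReal_nonneg
  have h1 : P.real A ≤ 1 := measureReal_le_one
  rw [logMomentIndicator, Real.le_log_iff_exp_le (one_add_exp_sub_one_mul_pos h0 h1 l)]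
  have := convexOn_exp.2 (Set.mem_univ (0 : ℝ)) (Set.mem_univ l) (sub_nonneg.2 h1) h0 (by ring)
  simp only [smul_eq_mul, mul_zero, zero_add, Real.exp_zero, mul_one] at this
  rw [mul_comm l]
  linarith

theorem HasRenyiBound.logMomentIndicator_le {Y : Type*} [MeasurableSpace Y] {ξ ρ : ℝ}
    {P Q : Measure Y} [IsProbabilityMeasure P] [IsProbabilityMeasure Q]
    (h : HasRenyiBound ξ ρ P Q) {θ : ℝ} (h0 : 0 < θ) (h1 : θ < 1) {A : Set Y}
    (hA : MeasurableSet A) (l : ℝ) :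
    logMomentIndicator P A (θ * l) ≤
      θ * (logMomentIndicator Q A l + (ξ + ρ / (1 - θ))) := by
  have hP := one_add_exp_sub_one_mul_pos (measureReal_nonneg (μ := P) (s := A))
    measureReal_le_one (θ * l)
  have hQ := one_add_exp_sub_one_mul_pos (measureReal_nonneg (μ := Q) (s := A))
    measureReal_le_one l
  have key := h.lintegral_le h0 h1
    (f := fun y => ENNReal.ofReal (Real.exp (A.indicator (fun _ => θ * l) y)))
    ((measurable_const.indicator hA).exp.ennreal_ofReal)
  have hpow : ∀ y, ENNReal.ofReal (Real.exp (A.indicator (fun _ => θ * l) y)) ^ (1 / θ) =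
      ENNReal.ofReal (Real.exp (A.indicator (fun _ => l) y)) := by
    intro y
    rw [ENNReal.ofReal_rpow_of_pos (Real.exp_pos _), ← Real.exp_mul]
    by_cases hy : y ∈ A
    · simp only [Set.indicator_of_mem hy]
      congr 2
      field_simp
    · simp [Set.indicator_of_notMem hy]
  simp only [hpow] at key
  rw [lintegral_exp_indicator P hA, lintegral_exp_indicator Q hA,
    ENNReal.ofReal_rpow_of_pos hQ, ← ENNReal.ofReal_mul (by positivity),
    ENNReal.ofReal_le_ofReal_iff (by positivity)] at key
  have := Real.log_le_log hP key
  rw [Real.log_mul (by positivity) (by positivity), Real.log_rpow hQ, Real.log_exp] at this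
  unfold logMomentIndicator
  linarith

/-- Group privacy along a chain of `n` steps, in the dual form of a bound on the Kullback-Leibler
divergence of `P 0` from `P n` tested on multiples of indicators. If `K n` is the bound after
`n` steps, Hölder's inequality gives `K (n + 1) = K n / θ + ξ + ρ / (1 - θ)` for every
`θ ∈ (0, 1)`; the choice `θ = n / (n + 1)` makes `K n / n` a telescoping sum. -/
theorem mul_measureReal_le_of_chain {Y : Type*} [MeasurableSpace Y] {ξ ρ : ℝ}
    {P : ℕ → Measure Y} [∀ j, IsProbabilityMeasure (P j)]
    (h : ∀ j, HasRenyiBound ξ ρ (P j) (P (j + 1))) {A : Set Y} (hA : MeasurableSet A)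
    {n : ℕ} (hn : 1 ≤ n) (l : ℝ) :
    l * (P 0).real A ≤
      n * (ρ * n + ξ * (harmonic n : ℝ)) + logMomentIndicator (P n) A l := by
  induction n, hn using Nat.le_induction generalizing l with
  | base =>
    -- the first step is the limit `θ → 0`
    have hlim : Filter.Tendsto (fun θ : ℝ => logMomentIndicator (P 1) A l + (ξ + ρ / (1 - θ)))
        (nhdsWithin 0 (Set.Ioi 0))
        (nhds (logMomentIndicator (P 1) A l + (ξ + ρ / (1 - 0)))) := by
      apply Filter.Tendsto.mono_left _ nhdsWithin_le_nhds
      apply ContinuousAt.tendsto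
      have : (1 : ℝ) - 0 ≠ 0 := by norm_num
      fun_prop (disch := assumption)
    have hle : l * (P 0).real A ≤ logMomentIndicator (P 1) A l + (ξ + ρ / (1 - 0)) := by
      refine ge_of_tendsto hlim ?_
      filter_upwards [Ioo_mem_nhdsGT (zero_lt_one (α := ℝ))] with θ hθ
      have h1 := mul_measureReal_le_logMomentIndicator (P 0) A (θ * l)
      have h2 := (h 0).logMomentIndicator_le hθ.1 hθ.2 hA l
      rw [zero_add] at h2
      refine le_of_mul_le_mul_left ?_ hθ.1
      linarith
    simp only [Nat.cast_one, one_mul, mul_one, harmonic_succ, harmonic_zero, zero_add, inv_one,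
      Rat.cast_one, sub_zero, div_one] at hle ⊢
    linarith
  | succ j hj ih =>
    have hj0 : (0 : ℝ) < j := by exact_mod_cast hj
    have hθ0 : (0 : ℝ) < j / (j + 1) := by positivity
    have hθ1 : (j : ℝ) / (j + 1) < 1 := by rw [div_lt_one (by positivity)]; linarith
    have h1 := ih (j / (j + 1) * l)
    have h2 := (h j).logMomentIndicator_le hθ0 hθ1 hA l
    have h3 : ρ / (1 - (j : ℝ) / (j + 1)) = ρ * (j + 1) := by field_simp; ring
    rw [h3] at h2
    refine le_of_mul_le_mul_left ?_ hθ0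
    rw [harmonic_succ]
    push_cast
    have h4 : (j : ℝ) / (j + 1) * ((j + 1) * (ρ * (j + 1) + ξ * ((harmonic j : ℝ) + (j + 1 : ℝ)⁻¹))
        + logMomentIndicator (P (j + 1)) A l) = j * (ρ * j + ξ * (harmonic j : ℝ)) +
        j / (j + 1) * (logMomentIndicator (P (j + 1)) A l + (ξ + ρ * (j + 1))) := by
      field_simp
      ring
    rw [h4]
    linarith

theorem IsZCDP.hasRenyiBound {X : Type*} {n : ℕ} {Y : Type*} [MeasurableSpace Y] {ξ ρ : ℝ}
    {M : Mechanism X n Y} (hM : IsZCDP ξ ρ M) (hnn : ∀ a : ℝ, 1 < a → 0 ≤ ξ + ρ * a)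
    {x x' : Fin n → X} (i : Fin n) (h : ∀ j, j ≠ i → x j = x' j) :
    HasRenyiBound ξ ρ (M x : Measure Y) (M x') := by
  by_cases hi : x i = x' i
  · have : x = x' := by
      funext j
      by_cases hj : j = i
      · rw [hj, hi]
      · exact h j hj
    rw [this]
    exact .refl _ hnn
  · exact hasRenyiBound_of_renyiDiv_le (hM x x' ⟨i, hi, h⟩)

theorem IsZCDP.nonneg {X : Type*} [Nontrivial X] {n : ℕ} (hn : 0 < n) {Y : Type*}
    [MeasurableSpace Y] {ξ ρ : ℝ} {M : Mechanism X n Y} (hM : IsZCDP ξ ρ M) {a : ℝ}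
    (ha : 1 < a) : 0 ≤ ξ + ρ * a := by
  obtain ⟨u, v, huv⟩ := exists_pair_ne X
  refine (hasRenyiBound_of_renyiDiv_le (hM (fun _ => u) (Function.update (fun _ => u) ⟨0, hn⟩ v)
    ⟨⟨0, hn⟩, ?_, ?_⟩)).nonneg ha
  · simpa using huv
  · intro j hj
    simp [Function.update_of_ne hj]

/-- Group privacy for arbitrary pairs of datasets of size `n`, which are joined by replacing the
entries one at a time. -/
theorem IsZCDP.mul_measureReal_le {X : Type*} [Nontrivial X] {n : ℕ} (hn : 0 < n) {Y : Type*}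
    [MeasurableSpace Y] {ξ ρ : ℝ} {M : Mechanism X n Y} (hM : IsZCDP ξ ρ M)
    (x x' : Fin n → X) {A : Set Y} (hA : MeasurableSet A) (l : ℝ) :
    l * (M x : Measure Y).real A ≤ n * (ρ * n + ξ * (harmonic n : ℝ)) +
      logMomentIndicator (M x' : Measure Y) A l := by
  let z : ℕ → Fin n → X := fun j i => if (i : ℕ) < j then x' i else x i
  have h := mul_measureReal_le_of_chain (P := fun j => (M (z j) : Measure Y)) (ξ := ξ) (ρ := ρ)
    (fun j => ?_) hA hn l
  · have h0 : z 0 = x := by funext i; simp [z]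
    have h1 : z n = x' := by funext i; simp [z]
    simpa only [h0, h1] using h
  · by_cases hj : j < n
    · refine hM.hasRenyiBound (fun a ha => hM.nonneg hn ha) ⟨j, hj⟩ fun i hi => ?_
      have : (i : ℕ) ≠ j := fun h => hi (Fin.ext h)
      have h2 : (i : ℕ) < j ↔ (i : ℕ) < j + 1 := by omega
      simp only [z, h2]
    · refine hM.hasRenyiBound (fun a ha => hM.nonneg hn ha) ⟨0, hn⟩ fun i _ => ?_
      have h2 : (i : ℕ) < j := by omega
      have h3 : (i : ℕ) < j + 1 := by omega
      simp only [z, h2, h3, if_true]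

/-! ### Packing bound for accurate mechanisms -/

theorem Seminorm.continuous_pi_fin {k : ℕ} (N : Seminorm ℝ (Fin k → ℝ)) : Continuous N :=
  continuousOn_univ.1 (N.convexOn.continuousOn isOpen_univ)

theorem Seminorm.measurable_sub_pi_fin {k : ℕ} (N : Seminorm ℝ (Fin k → ℝ)) (v : Fin k → ℝ) :
    Measurable fun y => N (y - v) :=
  (N.continuous_pi_fin.comp (continuous_id.sub continuous_const)).measurable

theorem half_le_measureReal_of_expectedError_le {X : Type*} {n k : ℕ} {α : ℝ} (hα : 0 < α)
    {N : Seminorm ℝ (Fin k → ℝ)} {q : X → Fin k → ℝ} {M : Mechanism X n (Fin k → ℝ)}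
    {x : Fin n → X} (h : expectedError N q M x ≤ ENNReal.ofReal α) :
    1 / 2 ≤ (M x : Measure (Fin k → ℝ)).real {y | N (y - statQuery q x) ≤ 2 * α} := by
  set P : Measure (Fin k → ℝ) := (M x).toMeasure
  have hmeas := N.measurable_sub_pi_fin (statQuery q x)
  have hm := (mul_meas_ge_le_lintegral (μ := P) hmeas.ennreal_ofReal
    (ENNReal.ofReal (2 * α))).trans h
  have hA : MeasurableSet {y | N (y - statQuery q x) ≤ 2 * α} :=
    measurableSet_le hmeas measurable_const
  have hsub : {y | N (y - statQuery q x) ≤ 2 * α}ᶜ ⊆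
      {y | ENNReal.ofReal (2 * α) ≤ ENNReal.ofReal (N (y - statQuery q x))} := by
    intro y hy
    simp only [Set.mem_compl_iff, Set.mem_ofPred_eq, not_le] at hy ⊢
    exact ENNReal.ofReal_le_ofReal hy.le
  have h2 : ENNReal.ofReal (2 * α) * P {y | N (y - statQuery q x) ≤ 2 * α}ᶜ ≤
      ENNReal.ofReal α := (by gcongr : _ ≤ _).trans hm
  rw [← ofReal_measureReal, ← ENNReal.ofReal_mul (by positivity),
    ENNReal.ofReal_le_ofReal_iff hα.le, probReal_compl_eq_one_sub hA] at h2
  nlinarith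

/-- Datasets whose query values are `4 * α`-separated have disjoint balls of radius `2 * α`, each
of probability at least `1 / 2` under its own output distribution. Some ball has probability at
most `1 / card T` under a fixed output distribution, and group privacy compares the two. -/
theorem IsZCDP.log_card_le {X : Type*} [Nontrivial X] {n k : ℕ} (hn : 0 < n) {α ξ ρ : ℝ}
    (hα : 0 < α) {N : Seminorm ℝ (Fin k → ℝ)} {q : X → Fin k → ℝ}
    {M : Mechanism X n (Fin k → ℝ)} (hM : IsZCDP ξ ρ M)
    (herr : ∀ x, expectedError N q M x ≤ ENNReal.ofReal α) {T : Finset (Fin n → X)}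
    (hT : T.Nonempty)
    (hsep : ∀ x ∈ T, ∀ x' ∈ T, x ≠ x' → 4 * α < N (statQuery q x - statQuery q x')) :
    Real.log T.card ≤ 2 * (n * (ρ * n + ξ * (harmonic n : ℝ)) + Real.log 2) := by
  obtain ⟨x₀, hx₀⟩ := id hT
  set P : Measure (Fin k → ℝ) := (M x₀).toMeasure
  let A : (Fin n → X) → Set (Fin k → ℝ) := fun x => {y | N (y - statQuery q x) ≤ 2 * α}
  have hA : ∀ x, MeasurableSet (A x) := fun x =>
    measurableSet_le (N.measurable_sub_pi_fin _) measurable_const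
  have hdisj : Set.PairwiseDisjoint (T : Set (Fin n → X)) A := by
    intro x hx x' hx' hne
    refine Set.disjoint_left.2 fun y hy hy' => ?_
    have h1 := hsep x hx x' hx' hne
    have h2 : N (statQuery q x - statQuery q x') ≤
        N (y - statQuery q x') + N (y - statQuery q x) := by
      rw [← map_sub_rev N (statQuery q x) y]
      refine (map_add_le_add N _ _).trans' (le_of_eq ?_)
      congr 1
      abel
    simp only [A, Set.mem_ofPred_eq] at hy hy'
    linarith
  have hcard : (1 : ℝ) ≤ T.card := by exact_mod_cast hT.card_pos
  have hsum : ∑ x ∈ T, P.real (A x) ≤ ∑ x ∈ T, (T.card : ℝ)⁻¹ := by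
    rw [← measureReal_biUnion_finset hdisj fun x _ => hA x, Finset.sum_const, nsmul_eq_mul,
      mul_inv_cancel₀ (by positivity)]
    exact measureReal_le_one
  obtain ⟨x, hxT, hx⟩ := Finset.exists_le_of_sum_le hT hsum
  have h1 := hM.mul_measureReal_le hn x x₀ (hA x) (Real.log T.card)
  have h2 := half_le_measureReal_of_expectedError_le hα (herr x)
  have h3 : logMomentIndicator P (A x) (Real.log T.card) ≤ Real.log 2 := by
    have h0 : 0 ≤ P.real (A x) := measureReal_nonneg
    rw [logMomentIndicator, Real.exp_log (by positivity)]
    have h4 : (T.card : ℝ) * P.real (A x) ≤ 1 := by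
      rw [← mul_inv_cancel₀ (show (T.card : ℝ) ≠ 0 by positivity)]
      gcongr
    apply Real.log_le_log
    · nlinarith
    · nlinarith
  have h5 : Real.log T.card * (1 / 2) ≤ Real.log T.card * (M x : Measure _).real (A x) :=
    mul_le_mul_of_nonneg_left h2 (Real.log_nonneg hcard)
  linarith

/-- A packing of maximal cardinality is a net: a finite set of query values on datasets of size
`n`, of controlled cardinality, that is `4 * α`-dense among all of them. -/
theorem IsZCDP.exists_net {X : Type*} [Nontrivial X] {n k : ℕ} (hn : 0 < n) {α ξ ρ : ℝ}
    (hα : 0 < α) {N : Seminorm ℝ (Fin k → ℝ)} {q : X → Fin k → ℝ}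
    {M : Mechanism X n (Fin k → ℝ)} (hM : IsZCDP ξ ρ M)
    (herr : ∀ x, expectedError N q M x ≤ ENNReal.ofReal α) :
    ∃ T : Finset (Fin n → X), T.Nonempty ∧
      Real.log T.card ≤ 2 * (n * (ρ * n + ξ * (harmonic n : ℝ)) + Real.log 2) ∧
      ∀ x : Fin n → X, ∃ t ∈ T, N (statQuery q t - statQuery q x) ≤ 4 * α := by
  classical
  let IsPacking : Finset (Fin n → X) → Prop := fun T =>
    T.Nonempty ∧
      ∀ x ∈ T, ∀ x' ∈ T, x ≠ x' → 4 * α < N (statQuery q x - statQuery q x')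
  set L := 2 * (n * (ρ * n + ξ * (harmonic n : ℝ)) + Real.log 2)
  have hbound : ∀ T, IsPacking T → T.card ≤ ⌊Real.exp L⌋₊ := by
    intro T hT
    have hc : (0 : ℝ) < T.card := by exact_mod_cast hT.1.card_pos
    have := hM.log_card_le hn hα herr hT.1 hT.2
    rw [Real.log_le_iff_le_exp hc] at this
    exact Nat.le_floor this
  let S : Set ℕ := {m | ∃ T, IsPacking T ∧ T.card = m}
  have hne : S.Nonempty := by
    obtain ⟨u⟩ : Nonempty X := inferInstance
    exact ⟨1, {fun _ => u}, ⟨Finset.singleton_nonempty _, by simp⟩, by simp⟩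
  have hbdd : BddAbove S := ⟨_, by rintro m ⟨T, hT, rfl⟩; exact hbound T hT⟩
  obtain ⟨T, hT, hTcard⟩ := Nat.sSup_mem hne hbdd
  refine ⟨T, hT.1, hM.log_card_le hn hα herr hT.1 hT.2, fun x => ?_⟩
  by_contra! hfar
  have hxT : x ∉ T := fun hx => by
    have := hfar x hx
    rw [sub_self, map_zero] at this
    linarith
  have hins : IsPacking (insert x T) := by
    refine ⟨Finset.insert_nonempty _ _, ?_⟩
    intro y hy y' hy' hne
    rw [Finset.mem_insert] at hy hy'
    rcases hy with rfl | hy <;> rcases hy' with rfl | hy'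
    · exact absurd rfl hne
    · rw [map_sub_rev]
      exact hfar y' hy'
    · exact hfar y hy
    · exact hT.2 y hy y' hy' hne
  have := le_csSup hbdd (show (insert x T).card ∈ S from ⟨_, hins, rfl⟩)
  rw [Finset.card_insert_of_notMem hxT, hTcard] at this
  omega

/-! ### Generalization from privacy -/

/-- The `χ²`-divergence, which is the moment of order `2`, controls the change in expectation of a
function bounded by `1`. The inequality is Cauchy-Schwarz with the square root linearised at `c`. -/
theorem HasRenyiBound.integral_sub_integral_le {Y : Type*} [MeasurableSpace Y] {ξ ρ : ℝ}
    {P Q : Measure Y} [IsProbabilityMeasure P] [IsProbabilityMeasure Q]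
    (h : HasRenyiBound ξ ρ P Q) {f : Y → ℝ} (hf : Measurable f) (hf1 : ∀ y, |f y| ≤ 1)
    {c : ℝ} (hc : 0 < c) :
    ∫ y, f y ∂P - ∫ y, f y ∂Q ≤ (Real.exp (ξ + 2 * ρ) - 1) / (2 * c) + c / 2 := by
  set r : Y → ℝ := fun y => (P.rnDeriv Q y).toReal with hr
  have hrm : Measurable r := (P.measurable_rnDeriv Q).ennreal_toReal
  have hmom : ∫⁻ y, ENNReal.ofReal (r y ^ 2) ∂Q ≤ ENNReal.ofReal (Real.exp (ξ + 2 * ρ)) := by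
    have h2 := h.2 2 (by norm_num)
    have e : (2 - 1 : ℝ) * (ξ + ρ * 2) = ξ + 2 * ρ := by ring
    rw [e] at h2
    refine (lintegral_congr_ae ?_).trans_le h2
    filter_upwards [P.rnDeriv_lt_top Q] with y hy
    rw [hr, ENNReal.ofReal_pow ENNReal.toReal_nonneg, ENNReal.ofReal_toReal hy.ne]
    norm_cast
  have hr2 : Integrable (fun y => r y ^ 2) Q := by
    refine ⟨(hrm.pow_const 2).aestronglyMeasurable, ?_⟩
    rw [hasFiniteIntegral_iff_ofReal (Filter.Eventually.of_forall fun y => sq_nonneg _)]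
    exact hmom.trans_lt ENNReal.ofReal_lt_top
  have hr2le : ∫ y, r y ^ 2 ∂Q ≤ Real.exp (ξ + 2 * ρ) := by
    rw [integral_eq_lintegral_of_nonneg_ae (Filter.Eventually.of_forall fun y => sq_nonneg _)
      (hrm.pow_const 2).aestronglyMeasurable]
    exact ENNReal.toReal_le_of_le_ofReal (Real.exp_pos _).le hmom
  have hr1 : Integrable r Q := Measure.integrable_toReal_rnDeriv
  have hr1eq : ∫ y, r y ∂Q = 1 := by
    have := integral_rnDeriv_smul h.1 (f := fun _ => (1 : ℝ))
    simpa using this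
  have hfQ : Integrable f Q := Integrable.of_bound hf.aestronglyMeasurable 1
    (Filter.Eventually.of_forall hf1)
  have hrf : Integrable (fun y => r y * f y) Q :=
    hr1.mul_bdd hf.aestronglyMeasurable (Filter.Eventually.of_forall hf1)
  have hP : ∫ y, f y ∂P = ∫ y, r y * f y ∂Q := (integral_rnDeriv_smul h.1).symm
  rw [hP, ← integral_sub hrf hfQ]
  have hint : Integrable (fun y => (r y ^ 2 - 2 * r y + 1) / (2 * c) + c / 2) Q :=
    (((hr2.sub (hr1.const_mul 2)).add (integrable_const 1)).div_const _).add (integrable_const _)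
  have hle : ∀ y, r y * f y - f y ≤ (r y ^ 2 - 2 * r y + 1) / (2 * c) + c / 2 := by
    intro y
    have h1 := (abs_le.1 (hf1 y))
    have h2 : f y ^ 2 ≤ 1 := by nlinarith
    rw [div_add_div _ _ (by positivity) (by norm_num), le_div_iff₀ (by positivity)]
    nlinarith [sq_nonneg ((r y - 1) - c * f y), mul_nonneg hc.le (sub_nonneg.2 h2)]
  refine (integral_mono (hrf.sub hfQ) hint hle).trans ?_
  have heq : ∫ y, ((r y ^ 2 - 2 * r y + 1) / (2 * c) + c / 2) ∂Q =
      (∫ y, r y ^ 2 ∂Q - 1) / (2 * c) + c / 2 := by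
    have h1 : Integrable (fun y => r y ^ 2 - 2 * r y) Q := hr2.sub (hr1.const_mul 2)
    have h2 : Integrable (fun y => r y ^ 2 - 2 * r y + 1) Q := h1.add (integrable_const 1)
    rw [integral_add (h2.div_const _) (integrable_const _), integral_div,
      integral_add h1 (integrable_const 1), integral_sub hr2 (hr1.const_mul 2),
      integral_const_mul, hr1eq]
    simp only [integral_const, probReal_univ, smul_eq_mul]
    ring
  rw [heq]
  gcongr

/-- Hahn-Banach: a norming functional for a seminorm. -/
theorem Seminorm.exists_dual_eq {E : Type*} [AddCommGroup E] [Module ℝ E] (N : Seminorm ℝ E)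
    (v : E) : ∃ g : E →ₗ[ℝ] ℝ, g v = N v ∧ ∀ u, |g u| ≤ N u := by
  by_cases hv : v = 0
  · exact ⟨0, by simp [hv], fun u => by simp⟩
  obtain ⟨g, hg1, hg2⟩ := exists_extension_of_le_sublinear
    (LinearPMap.mkSpanSingleton v (N v) hv) N
    (fun c hc x => by rw [map_smul_eq_mul, Real.norm_of_nonneg hc.le])
    (fun x y => map_add_le_add N x y) (by
      rintro ⟨x, hx⟩
      obtain ⟨c, rfl⟩ := Submodule.mem_span_singleton.1 hx
      refine (LinearPMap.mkSpanSingleton'_apply v (N v) _ c hx).trans_le ?_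
      rw [map_smul_eq_mul, smul_eq_mul]
      exact mul_le_mul_of_nonneg_right (le_abs_self c) (apply_nonneg N v))
  refine ⟨g, ?_, fun u => abs_le.2 ⟨?_, hg2 u⟩⟩
  · exact (hg1 ⟨v, Submodule.mem_span_singleton_self v⟩).trans
      (LinearPMap.mkSpanSingleton_apply ℝ ℝ hv (N v))
  · have := hg2 (-u)
    rw [map_neg, map_neg_eq_map] at this
    linarith

/-- A measurable choice of functionals that are norming for `y - v` up to `δ`. It depends on `y`
only through the first close enough point of a dense sequence, so that it takes countably many
values. -/
theorem Seminorm.exists_measurable_dual {k : ℕ} (N : Seminorm ℝ (Fin k → ℝ)) (v : Fin k → ℝ)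
    {δ : ℝ} (hδ : 0 < δ) :
    ∃ w : (Fin k → ℝ) → ((Fin k → ℝ) →ₗ[ℝ] ℝ), (∀ u, Measurable fun y => w y u) ∧
      (∀ y u, |w y u| ≤ N u) ∧ ∀ y, N (y - v) ≤ w y (y - v) + δ := by
  classical
  let d := TopologicalSpace.denseSeq (Fin k → ℝ)
  choose g hg1 hg2 using fun m => N.exists_dual_eq (d m - v)
  have hex : ∀ y, ∃ m, N (y - d m) < δ / 2 := by
    intro y
    have hopen : IsOpen {z | N (y - z) < δ / 2} :=
      isOpen_lt (N.continuous_pi_fin.comp (continuous_const.sub continuous_id)) continuous_const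
    obtain ⟨m, hm⟩ := (TopologicalSpace.denseRange_denseSeq (Fin k → ℝ)).exists_mem_open hopen
      ⟨y, by simpa using hδ⟩
    exact ⟨m, hm⟩
  refine ⟨fun y => g (Nat.find (hex y)), fun u => ?_, fun y u => hg2 _ u, fun y => ?_⟩
  · have hfind : Measurable fun y => Nat.find (hex y) :=
      measurable_find _ fun m => measurableSet_lt (N.measurable_sub_pi_fin _) measurable_const
    exact (measurable_from_nat (f := fun m => g m u)).comp hfind
  · have hm := Nat.find_spec (hex y)
    set m := Nat.find (hex y)
    have h1 : N (y - v) ≤ N (y - d m) + N (d m - v) :=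
      (map_add_le_add N _ _).trans' (le_of_eq (by congr 1; abel))
    have h2 : g m (d m - v) = g m (y - v) - g m (y - d m) := by
      rw [← map_sub]
      congr 1
      abel
    have h3 := (abs_le.1 (hg2 m (y - d m))).2
    have h4 := hg1 m
    have h5 := (abs_le.1 (hg2 m (y - d m))).1
    linarith

theorem Function.sum_update_eq {ι κ : Type*} [Fintype ι] [DecidableEq ι] [Fintype κ]
    (i : ι) (F : κ → (ι → κ) → ℝ) :
    ∑ s : ι → κ, ∑ j, F j (Function.update s i j) = Fintype.card κ * ∑ s : ι → κ, F (s i) s := by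
  have hinv : Function.Involutive
      (fun p : (ι → κ) × κ => (Function.update p.1 i p.2, p.1 i)) := by
    rintro ⟨s, j⟩
    simp
  rw [← Fintype.sum_prod_type' (f := fun s j => F j (Function.update s i j))]
  have h := Equiv.sum_comp (hinv.toPerm _) fun p : (ι → κ) × κ => F (p.1 i) p.1
  simp only [Function.Involutive.coe_toPerm, Function.update_self] at h
  rw [h, Fintype.sum_prod_type]
  simp [Finset.mul_sum]

theorem map_statQuery {X : Type*} {k n : ℕ} (q : X → Fin k → ℝ) (x : Fin n → X)
    (g : (Fin k → ℝ) →ₗ[ℝ] ℝ) : g (statQuery q x) = (n : ℝ)⁻¹ * ∑ i, g (q (x i)) := by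
  rw [statQuery, map_smul, map_sum, smul_eq_mul]

/-- Some subsample of size `n` of a dataset approximates its query values, because an accurate
private mechanism on subsamples drawn at random with replacement generalizes. The error
functional is allowed to depend on the output of the mechanism; replacing one entry of the
subsample by a fresh one barely changes its expectation, by privacy. -/
theorem IsZCDP.exists_subsample {X : Type*} [Nontrivial X] {n n' k : ℕ} (hn : 0 < n)
    (hn' : 0 < n') {α ξ ρ : ℝ} (hα : 0 < α) {N : Seminorm ℝ (Fin k → ℝ)} {q : X → Fin k → ℝ}
    (hq : ∀ z, N (q z) ≤ 1) {M : Mechanism X n (Fin k → ℝ)} (hM : IsZCDP ξ ρ M)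
    (herr : ∀ x, expectedError N q M x ≤ ENNReal.ofReal α) {c δ : ℝ} (hc : 0 < c) (hδ : 0 < δ)
    (x : Fin n' → X) :
    ∃ s : Fin n → Fin n', N (statQuery q (x ∘ s) - statQuery q x) ≤
      2 * α + δ + ((Real.exp (ξ + 2 * ρ) - 1) / (2 * c) + c / 2) := by
  set η := (Real.exp (ξ + 2 * ρ) - 1) / (2 * c) + c / 2
  set v := statQuery q x
  obtain ⟨w, hwm, hwN, hwv⟩ := N.exists_measurable_dual v hδ
  have hn0 : (0 : ℝ) < n := by exact_mod_cast hn
  have hn0' : (0 : ℝ) < n' := by exact_mod_cast hn'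
  have : Nonempty (Fin n') := ⟨⟨0, hn'⟩⟩
  let P : (Fin n → Fin n') → Measure (Fin k → ℝ) := fun s => (M (x ∘ s)).toMeasure
  have hP : ∀ s, IsProbabilityMeasure (P s) := fun s => inferInstanceAs
    (IsProbabilityMeasure (M (x ∘ s)).toMeasure)
  let G : Fin n' → (Fin n → Fin n') → ℝ := fun j s => ∫ y, w y (q (x j)) ∂P s
  have hwint : ∀ u s, Integrable (fun y => w y u) (P s) := fun u s =>
    Integrable.of_bound (hwm u).aestronglyMeasurable (N u)
      (Filter.Eventually.of_forall fun y => hwN y u)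
  -- privacy: changing one entry of the subsample
  have hG : ∀ i s j, G j (Function.update s i j) ≤ G j s + η := by
    intro i s j
    have hb : HasRenyiBound ξ ρ (P (Function.update s i j)) (P s) := by
      refine hM.hasRenyiBound (fun a ha => hM.nonneg hn ha) i fun l hl => ?_
      simp [Function.update_of_ne hl]
    have := hb.integral_sub_integral_le (hwm (q (x j))) (fun y => (hwN y _).trans (hq _)) hc
    exact sub_le_iff_le_add'.1 this
  have hsum : ∀ i, ∑ s, G (s i) s ≤ ∑ s, ((n' : ℝ)⁻¹ * ∑ j, G j s + η) := by
    intro i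
    have h1 := Function.sum_update_eq i G
    rw [Fintype.card_fin] at h1
    have h2 : ∑ s, ∑ j, G j (Function.update s i j) ≤ ∑ s, ∑ j, (G j s + η) :=
      Finset.sum_le_sum fun s _ => Finset.sum_le_sum fun j _ => hG i s j
    rw [h1] at h2
    refine le_of_mul_le_mul_left (h2.trans_eq ?_) hn0'
    rw [Finset.mul_sum]
    refine Finset.sum_congr rfl fun s _ => ?_
    rw [Finset.sum_add_distrib, mul_add, mul_inv_cancel_left₀ hn0'.ne']
    simp
  have hpoint : ∀ s : Fin n → Fin n', N (statQuery q (x ∘ s) - v) ≤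
      2 * α + δ + ((n : ℝ)⁻¹ * ∑ i, G (s i) s - (n' : ℝ)⁻¹ * ∑ j, G j s) := by
    intro s
    have hmeas := N.measurable_sub_pi_fin (statQuery q (x ∘ s))
    have hle : ∫⁻ y, ENNReal.ofReal (N (y - statQuery q (x ∘ s))) ∂P s ≤ ENNReal.ofReal α :=
      herr (x ∘ s)
    have hint : Integrable (fun y => N (y - statQuery q (x ∘ s))) (P s) := by
      refine ⟨hmeas.aestronglyMeasurable, ?_⟩
      rw [hasFiniteIntegral_iff_ofReal (Filter.Eventually.of_forall fun y => apply_nonneg N _)]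
      exact hle.trans_lt ENNReal.ofReal_lt_top
    have hintle : ∫ y, N (y - statQuery q (x ∘ s)) ∂P s ≤ α := by
      rw [integral_eq_lintegral_of_nonneg_ae
        (Filter.Eventually.of_forall fun y => apply_nonneg N _) hmeas.aestronglyMeasurable]
      exact ENNReal.toReal_le_of_le_ofReal hα.le hle
    have hy : ∀ y, N (statQuery q (x ∘ s) - v) ≤
        2 * N (y - statQuery q (x ∘ s)) + w y (statQuery q (x ∘ s) - v) + δ := by
      intro y
      have h1 : N (statQuery q (x ∘ s) - v) ≤ N (y - statQuery q (x ∘ s)) + N (y - v) := by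
        rw [← map_sub_rev N (statQuery q (x ∘ s)) y]
        refine (map_add_le_add N _ _).trans' (le_of_eq ?_)
        congr 1
        abel
      have h2 : w y (y - v) =
          w y (y - statQuery q (x ∘ s)) + w y (statQuery q (x ∘ s) - v) := by
        rw [← map_add]
        congr 1
        abel
      have h3 := (abs_le.1 (hwN y (y - statQuery q (x ∘ s)))).2
      have h4 := hwv y
      linarith
    have hI := integral_mono (μ := P s) (integrable_const _)
      (((hint.const_mul 2).add (hwint (statQuery q (x ∘ s) - v) s)).add (integrable_const δ)) hy
    have h2 : Integrable (fun y => 2 * N (y - statQuery q (x ∘ s)) +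
        w y (statQuery q (x ∘ s) - v)) (P s) :=
      (hint.const_mul 2).add (hwint (statQuery q (x ∘ s) - v) s)
    have hlin : ∫ y, w y (statQuery q (x ∘ s) - v) ∂P s =
        (n : ℝ)⁻¹ * ∑ i, G (s i) s - (n' : ℝ)⁻¹ * ∑ j, G j s := by
      simp only [map_sub]
      rw [integral_sub (hwint _ s) (hwint _ s)]
      simp only [v, map_statQuery]
      rw [integral_const_mul, integral_const_mul, integral_finsetSum _ fun i _ => hwint _ s,
        integral_finsetSum _ fun i _ => hwint _ s]
      rfl
    simp only [Pi.add_apply] at hI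
    rw [integral_add h2 (integrable_const δ),
      integral_add (hint.const_mul 2) (hwint _ s), integral_const_mul, hlin] at hI
    simp only [integral_const, probReal_univ, smul_eq_mul, one_mul] at hI
    linarith
  have htotal : ∑ s : Fin n → Fin n', N (statQuery q (x ∘ s) - v) ≤
      ∑ _s : Fin n → Fin n', (2 * α + δ + η) := by
    refine (Finset.sum_le_sum fun s _ => hpoint s).trans ?_
    have h1 : ∑ i : Fin n, ∑ s, G (s i) s ≤ ∑ _i : Fin n, ∑ s, ((n' : ℝ)⁻¹ * ∑ j, G j s + η) :=
      Finset.sum_le_sum fun i _ => hsum i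
    rw [Finset.sum_comm, Finset.sum_const, Finset.card_univ, Fintype.card_fin, nsmul_eq_mul] at h1
    have h2 : (n : ℝ)⁻¹ * ∑ s, ∑ i, G (s i) s ≤ ∑ s, ((n' : ℝ)⁻¹ * ∑ j, G j s + η) := by
      rw [inv_mul_le_iff₀ hn0]
      exact h1
    rw [Finset.mul_sum, Finset.sum_add_distrib] at h2
    simp only [Finset.sum_add_distrib, Finset.sum_sub_distrib]
    linarith
  obtain ⟨s, -, hs⟩ := Finset.exists_le_of_sum_le Finset.univ_nonempty htotal
  exact ⟨s, hs⟩

/-! ### The exponential mechanism -/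

/-- The normalising constant of the Gibbs distribution on `T` with energy `d` at inverse
temperature `η`. -/
noncomputable def gibbsSum {ι : Type*} (T : Finset ι) (η : ℝ) (d : ι → ℝ) : ℝ :=
  ∑ t ∈ T, Real.exp (-(η * d t))

theorem gibbsSum_pos {ι : Type*} {T : Finset ι} (hT : T.Nonempty) (η : ℝ) (d : ι → ℝ) :
    0 < gibbsSum T η d :=
  Finset.sum_pos (fun _ _ => Real.exp_pos _) hT

/-- The law of `f t`, for `t` drawn from the Gibbs distribution on `T` with energy `d` at inverse
temperature `η`. -/
noncomputable def gibbsMeasure {ι Y : Type*} [MeasurableSpace Y] (T : Finset ι) (η : ℝ)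
    (d : ι → ℝ) (f : ι → Y) : Measure Y :=
  ∑ t ∈ T, ENNReal.ofReal (Real.exp (-(η * d t)) / gibbsSum T η d) • Measure.dirac (f t)

theorem sum_gibbs_eq_one {ι : Type*} {T : Finset ι} (hT : T.Nonempty) (η : ℝ) (d : ι → ℝ) :
    ∑ t ∈ T, Real.exp (-(η * d t)) / gibbsSum T η d = 1 := by
  rw [← Finset.sum_div]
  exact div_self (gibbsSum_pos hT η d).ne'

theorem gibbs_nonneg {ι : Type*} (T : Finset ι) (η : ℝ) (d : ι → ℝ) (t : ι) :
    0 ≤ Real.exp (-(η * d t)) / gibbsSum T η d :=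
  div_nonneg (Real.exp_pos _).le (Finset.sum_nonneg fun _ _ => (Real.exp_pos _).le)

theorem lintegral_gibbsMeasure {ι Y : Type*} [MeasurableSpace Y] (T : Finset ι) (η : ℝ)
    (d : ι → ℝ) (f : ι → Y) {g : Y → ℝ≥0∞} (hg : Measurable g) :
    ∫⁻ y, g y ∂gibbsMeasure T η d f =
      ∑ t ∈ T, ENNReal.ofReal (Real.exp (-(η * d t)) / gibbsSum T η d) * g (f t) := by
  rw [gibbsMeasure, lintegral_finsetSum_measure]
  refine Finset.sum_congr rfl fun t _ => ?_
  rw [lintegral_smul_measure, lintegral_dirac' _ hg, smul_eq_mul]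

theorem gibbsMeasure_apply {ι Y : Type*} [MeasurableSpace Y] (T : Finset ι) (η : ℝ)
    (d : ι → ℝ) (f : ι → Y) {S : Set Y} (hS : MeasurableSet S) [DecidablePred fun t => f t ∈ S] :
    gibbsMeasure T η d f S =
      ENNReal.ofReal (∑ t ∈ T with f t ∈ S, Real.exp (-(η * d t)) / gibbsSum T η d) := by
  rw [ENNReal.ofReal_sum_of_nonneg fun t _ => gibbs_nonneg T η d t, Finset.sum_filter,
    gibbsMeasure, Measure.finsetSum_apply]
  refine Finset.sum_congr rfl fun t _ => ?_
  by_cases ht : f t ∈ S <;> simp [Measure.dirac_apply' _ hS, ht]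

theorem isProbabilityMeasure_gibbsMeasure {ι Y : Type*} [MeasurableSpace Y] {T : Finset ι}
    (hT : T.Nonempty) (η : ℝ) (d : ι → ℝ) (f : ι → Y) :
    IsProbabilityMeasure (gibbsMeasure T η d f) := by
  classical
  refine ⟨?_⟩
  rw [gibbsMeasure_apply T η d f MeasurableSet.univ]
  simp [sum_gibbs_eq_one hT]

theorem gibbsMeasure_real {ι Y : Type*} [MeasurableSpace Y] (T : Finset ι) (η : ℝ)
    (d : ι → ℝ) (f : ι → Y) {S : Set Y} (hS : MeasurableSet S) [DecidablePred fun t => f t ∈ S] :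
    (gibbsMeasure T η d f).real S =
      ∑ t ∈ T with f t ∈ S, Real.exp (-(η * d t)) / gibbsSum T η d := by
  rw [measureReal_def, gibbsMeasure_apply T η d f hS,
    ENNReal.toReal_ofReal (Finset.sum_nonneg fun t _ => gibbs_nonneg T η d t)]

/-- Energies that are uniformly `Δ`-close give Gibbs distributions whose densities are within a
factor `exp (2 * η * Δ)`: one factor `exp (η * Δ)` is for the weights and one for the
normalisation. -/
theorem gibbsMeasure_real_le {ι Y : Type*} [MeasurableSpace Y] {T : Finset ι} (hT : T.Nonempty)
    {η Δ : ℝ} (hη : 0 ≤ η) {d d' : ι → ℝ} (h : ∀ t, |d t - d' t| ≤ Δ) (f : ι → Y)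
    {S : Set Y} (hS : MeasurableSet S) :
    (gibbsMeasure T η d f).real S ≤
      Real.exp (2 * η * Δ) * (gibbsMeasure T η d' f).real S := by
  classical
  have hw : ∀ d d' : ι → ℝ, (∀ t, |d t - d' t| ≤ Δ) → ∀ t,
      Real.exp (-(η * d t)) ≤ Real.exp (η * Δ) * Real.exp (-(η * d' t)) := by
    intro d d' h t
    rw [← Real.exp_add, Real.exp_le_exp]
    have := mul_le_mul_of_nonneg_left (abs_le.1 (h t)).1 hη
    linarith
  have hZ : gibbsSum T η d' ≤ Real.exp (η * Δ) * gibbsSum T η d := by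
    rw [gibbsSum, gibbsSum, Finset.mul_sum]
    exact Finset.sum_le_sum fun t _ => hw d' d (fun t => by rw [abs_sub_comm]; exact h t) t
  have hZ0 := gibbsSum_pos hT η d
  have hZ0' := gibbsSum_pos hT η d'
  rw [gibbsMeasure_real T η d f hS, gibbsMeasure_real T η d' f hS, Finset.mul_sum]
  refine Finset.sum_le_sum fun t _ => ?_
  rw [← mul_div_assoc, div_le_div_iff₀ hZ0 hZ0']
  have h1 := mul_le_mul (hw d d' h t) hZ hZ0'.le (by positivity)
  have h2 : Real.exp (2 * η * Δ) = Real.exp (η * Δ) * Real.exp (η * Δ) := by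
    rw [← Real.exp_add]
    ring_nf
  rw [h2]
  linarith

/-- The Gibbs variational principle: the mean energy plus the entropy term is at most the minimal
energy, and the entropy is at most `log (card T)`. -/
theorem sum_gibbs_mul_le {ι : Type*} {T : Finset ι} {η : ℝ} (hη : 0 < η)
    {d : ι → ℝ} {t₀ : ι} (ht₀ : t₀ ∈ T) :
    ∑ t ∈ T, Real.exp (-(η * d t)) / gibbsSum T η d * d t ≤
      d t₀ + Real.log T.card / η := by
  have hT : T.Nonempty := ⟨t₀, ht₀⟩
  set Z := gibbsSum T η d
  have hZ : 0 < Z := gibbsSum_pos hT η d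
  have hc : (0 : ℝ) < T.card := by exact_mod_cast hT.card_pos
  have hmin : -(η * d t₀) ≤ Real.log Z := by
    rw [Real.le_log_iff_exp_le hZ]
    exact Finset.single_le_sum (f := fun t => Real.exp (-(η * d t)))
      (fun t _ => (Real.exp_pos _).le) ht₀
  have hterm : ∀ t ∈ T, Real.exp (-(η * d t)) / Z * (η * d t + Real.log Z - Real.log T.card) ≤
      (T.card : ℝ)⁻¹ - Real.exp (-(η * d t)) / Z := by
    intro t _
    have hp : 0 < Real.exp (-(η * d t)) / Z := by positivity
    have h1 := Real.log_le_sub_one_of_pos (inv_pos.2 (mul_pos hp hc))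
    rw [Real.log_inv, Real.log_mul hp.ne' hc.ne', Real.log_div (Real.exp_pos _).ne' hZ.ne',
      Real.log_exp] at h1
    have h2 := mul_le_mul_of_nonneg_left h1 hp.le
    have h3 : Real.exp (-(η * d t)) / Z * ((Real.exp (-(η * d t)) / Z * T.card)⁻¹ - 1) =
        (T.card : ℝ)⁻¹ - Real.exp (-(η * d t)) / Z := by
      field_simp
    rw [h3] at h2
    refine h2.trans' (le_of_eq ?_)
    ring
  have hsum := Finset.sum_le_sum hterm
  have h1 : ∑ t ∈ T, Real.exp (-(η * d t)) / Z = 1 := sum_gibbs_eq_one hT η d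
  rw [Finset.sum_sub_distrib, h1, Finset.sum_const, nsmul_eq_mul, mul_inv_cancel₀ hc.ne',
    sub_self] at hsum
  have h2 : ∑ t ∈ T, Real.exp (-(η * d t)) / Z * (η * d t + Real.log Z - Real.log T.card) =
      η * ∑ t ∈ T, Real.exp (-(η * d t)) / Z * d t + (Real.log Z - Real.log T.card) := by
    rw [← one_mul (Real.log Z - Real.log T.card), ← h1, Finset.mul_sum, Finset.sum_mul,
      ← Finset.sum_add_distrib]
    exact Finset.sum_congr rfl fun t _ => by ring
  rw [h2] at hsum
  refine le_of_mul_le_mul_left ?_ hη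
  rw [mul_add, mul_div_cancel₀ _ hη.ne']
  linarith

theorem sum_gibbs_filter_le {ι : Type*} {T : Finset ι} {η : ℝ} (hη : 0 < η)
    {d : ι → ℝ} {t₀ : ι} (ht₀ : t₀ ∈ T) (τ : ℝ) :
    ∑ t ∈ T with τ < d t, Real.exp (-(η * d t)) / gibbsSum T η d ≤
      T.card * Real.exp (-(η * (τ - d t₀))) := by
  have hZ : 0 < gibbsSum T η d := gibbsSum_pos ⟨t₀, ht₀⟩ η d
  have hmin : Real.exp (-(η * d t₀)) ≤ gibbsSum T η d :=
    Finset.single_le_sum (f := fun t => Real.exp (-(η * d t)))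
      (fun t _ => (Real.exp_pos _).le) ht₀
  calc _ ≤ ∑ t ∈ T with τ < d t, Real.exp (-(η * (τ - d t₀))) := by
        refine Finset.sum_le_sum fun t ht => ?_
        rw [div_le_iff₀ hZ]
        refine le_trans ?_ (mul_le_mul_of_nonneg_left hmin (Real.exp_pos _).le)
        rw [← Real.exp_add, Real.exp_le_exp]
        have := mul_le_mul_of_nonneg_left (Finset.mem_filter.1 ht).2.le hη.le
        linarith
    _ ≤ _ := by
        rw [Finset.sum_const, nsmul_eq_mul]
        gcongr
        exact Finset.filter_subset _ _

theorem Neighbouring.abs_sub_le {X : Type*} {n k : ℕ} {N : Seminorm ℝ (Fin k → ℝ)}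
    {q : X → Fin k → ℝ} (hq : ∀ z, N (q z) ≤ 1) {x x' : Fin n → X} (h : Neighbouring x x')
    (u : Fin k → ℝ) :
    |N (u - statQuery q x) - N (u - statQuery q x')| ≤ 2 / n := by
  obtain ⟨i, -, hi⟩ := h
  have h1 : statQuery q x - statQuery q x' = (n : ℝ)⁻¹ • (q (x i) - q (x' i)) := by
    rw [statQuery, statQuery, ← smul_sub, ← Finset.sum_sub_distrib]
    congr 1
    refine Finset.sum_eq_single i (fun j _ hj => ?_) (by simp)
    rw [hi j hj, sub_self]
  refine (abs_sub_map_le_sub N _ _).trans ?_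
  rw [sub_sub_sub_cancel_left, map_sub_rev, h1, map_smul_eq_mul, norm_inv, Real.norm_natCast,
    div_eq_inv_mul]
  gcongr
  have := map_sub_le_add N (q (x i)) (q (x' i))
  linarith [hq (x i), hq (x' i)]

/-- The exponential mechanism over a net of candidate values, with its privacy, expected error and
tail. -/
theorem exists_isDP_of_net {X ι : Type*} {n k : ℕ} (hn : 0 < n) {ε τ : ℝ} (hε : 0 < ε)
    {N : Seminorm ℝ (Fin k → ℝ)} {q : X → Fin k → ℝ} (hq : ∀ z, N (q z) ≤ 1)
    {T : Finset ι} (hT : T.Nonempty) (f : ι → Fin k → ℝ)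
    (hnet : ∀ x : Fin n → X, ∃ t ∈ T,
      N (f t - statQuery q x) + Real.log T.card / (ε * n / 4) ≤ τ) :
    ∃ M : Mechanism X n (Fin k → ℝ), IsDP ε 0 M ∧
      (∀ x, expectedError N q M x ≤ ENNReal.ofReal τ) ∧
      ∀ x, ∀ β : ℝ, 0 < β →
        (M x : Measure (Fin k → ℝ)).real
          {y | τ + 4 / (ε * n) * Real.log (1 / β) < N (y - statQuery q x)} ≤ β := by
  classical
  have hn0 : (0 : ℝ) < n := by exact_mod_cast hn
  set η := ε * n / 4 with hηdef
  have hη : 0 < η := by positivity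
  let d : (Fin n → X) → ι → ℝ := fun x t => N (f t - statQuery q x)
  refine ⟨fun x => ⟨gibbsMeasure T η (d x) f, isProbabilityMeasure_gibbsMeasure hT _ _ _⟩,
    ?_, ?_, ?_⟩
  · intro x x' hx S hS
    rw [add_zero]
    have h1 := gibbsMeasure_real_le hT hη.le (fun t => hx.abs_sub_le hq (f t)) f hS
    have h2 : 2 * η * (2 / n) = ε := by
      rw [hηdef]
      field_simp
      norm_num
    rwa [h2] at h1
  · intro x
    obtain ⟨t₀, ht₀, hτ⟩ := hnet x
    change ∫⁻ y, ENNReal.ofReal (N (y - statQuery q x)) ∂gibbsMeasure T η (d x) f ≤ _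
    rw [lintegral_gibbsMeasure T η (d x) f (N.measurable_sub_pi_fin _).ennreal_ofReal]
    have h1 := (sum_gibbs_mul_le hη (d := d x) ht₀).trans hτ
    refine le_trans (le_of_eq ?_) (ENNReal.ofReal_le_ofReal h1)
    rw [ENNReal.ofReal_sum_of_nonneg fun t _ =>
      mul_nonneg (gibbs_nonneg T η (d x) t) (apply_nonneg N _)]
    exact Finset.sum_congr rfl fun t _ => (ENNReal.ofReal_mul (gibbs_nonneg T η (d x) t)).symm
  · intro x β hβ
    obtain ⟨t₀, ht₀, hτ⟩ := hnet x
    change (gibbsMeasure T η (d x) f).real _ ≤ β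
    set b := τ + 4 / (ε * n) * Real.log (1 / β) with hb
    rw [gibbsMeasure_real T η (d x) f
      (measurableSet_lt measurable_const (N.measurable_sub_pi_fin _))]
    refine (sum_gibbs_filter_le hη (d := d x) ht₀ b).trans ?_
    have hc : (0 : ℝ) < T.card := by exact_mod_cast hT.card_pos
    rw [← Real.exp_log hc, ← Real.exp_add]
    refine (Real.exp_le_exp.2 ?_).trans_eq (Real.exp_log hβ)
    have h1 : η * b = η * τ - Real.log β := by
      rw [hb, hηdef, one_div, Real.log_inv]
      field_simp
      ring
    have h2 := mul_le_mul_of_nonneg_left hτ hη.le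
    rw [mul_add, mul_div_cancel₀ _ hη.ne'] at h2
    rw [mul_sub, h1]
    simp only [d]
    linarith

/-! ### Numerical estimates and the conclusion -/

theorem exp_sub_one_le_of_le {u b : ℝ} (h0 : 0 ≤ u) (h1 : u ≤ b) (hb : b ≤ 3 / 100) :
    Real.exp u - 1 ≤ 103 / 100 * b := by
  have h := Real.abs_exp_sub_one_sub_id_le (x := u) (by rw [abs_of_nonneg h0]; linarith)
  have := (abs_le.1 h).2
  nlinarith

theorem group_privacy_le_of_nonneg {n : ℕ} {ξ ρ : ℝ} (hξ : 0 ≤ ξ) :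
    2 * (n * (ρ * n + ξ * (harmonic n : ℝ)) + Real.log 2) ≤
      2 * (ρ * (n : ℝ) ^ 2 + ξ * n * (1 + Real.log n) + 1) := by
  have h1 := mul_le_mul_of_nonneg_left (harmonic_le_one_add_log n)
    (mul_nonneg hξ (Nat.cast_nonneg (α := ℝ) n))
  have h2 := Real.log_two_lt_d9
  nlinarith

/-- For negative `ξ` the bound `harmonic n ≤ 1 + log n` goes in the wrong direction. The converse
`log n ≤ harmonic n` costs an extra `ρ * n`, which is absorbed by the constant when `n` is small
and by the quadratic term when `n` is large. -/
theorem group_privacy_le_of_neg {n : ℕ} (hn : 0 < n) {ξ ρ : ℝ} (hξ : ξ ≤ 0) (hξρ : 0 ≤ ξ + ρ)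
    (hρ : ρ ≤ 1 / 100) :
    2 * (n * (ρ * n + ξ * (harmonic n : ℝ)) + Real.log 2) ≤
      5 / 2 * (ρ * (n : ℝ) ^ 2 + ξ * n * (1 + Real.log n) + 1) := by
  have hn1 : (1 : ℝ) ≤ n := by exact_mod_cast hn
  have hlog0 : 0 ≤ Real.log n := Real.log_nonneg hn1
  have hl2 := Real.log_two_lt_d9
  have hharm : Real.log n ≤ (harmonic n : ℝ) := by
    refine le_trans (Real.log_le_log (by linarith) ?_) (log_add_one_le_harmonic n)
    push_cast
    linarith
  have hlog : Real.log n ≤ n / 8 + 11 / 10 := by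
    have h1 := Real.log_le_sub_one_of_pos (show (0 : ℝ) < n / 8 by linarith)
    have h8 : Real.log 8 = 3 * Real.log 2 := by
      rw [show (8 : ℝ) = 2 ^ 3 by norm_num, Real.log_pow]
      norm_num
    rw [Real.log_div (by linarith) (by norm_num), h8] at h1
    linarith
  have hρ0 : 0 ≤ ρ := by linarith
  have h1 : ξ * n * (harmonic n : ℝ) ≤ ξ * n * Real.log n :=
    mul_le_mul_of_nonpos_left hharm (mul_nonpos_of_nonpos_of_nonneg hξ (by linarith))
  have h2 : -(ρ * n) ≤ ξ * n := by nlinarith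
  have hB : ρ * n * (n - 1 - Real.log n) ≤ ρ * (n : ℝ) ^ 2 + ξ * n * (1 + Real.log n) := by
    have := mul_le_mul_of_nonneg_right h2 (show 0 ≤ 1 + Real.log n by linarith)
    linarith
  have hρn : 0 ≤ ρ * n := by positivity
  have key : 2 * (ρ * n) ≤ 1 / 2 * (ρ * (n : ℝ) ^ 2 + ξ * n * (1 + Real.log n)) + 11 / 10 := by
    rcases le_total (n : ℝ) 55 with h | h
    · have h3 : 0 ≤ n - 1 - Real.log n := by
        have := Real.log_le_sub_one_of_pos (show (0 : ℝ) < n by linarith)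
        linarith
      have h4 := mul_nonneg hρn h3
      have h5 : ρ * n ≤ 1 / 100 * 55 := mul_le_mul hρ h (by linarith) (by norm_num)
      linarith
    · have h3 : 4 ≤ n - 1 - Real.log n := by linarith
      have h4 := mul_le_mul_of_nonneg_left h3 hρn
      linarith
  linarith

theorem isDP_zero_of_const {X : Type*} {n : ℕ} {Y : Type*} [MeasurableSpace Y] {ε : ℝ}
    (hε : 0 ≤ ε) (P : ProbabilityMeasure Y) : IsDP ε 0 (fun _ : Fin n → X => P) := by
  intro x x' _ S _
  rw [add_zero]
  exact le_mul_of_one_le_left measureReal_nonneg (Real.one_le_exp hε)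

/-- A deterministic mechanism with error at most `τ` everywhere satisfies the accuracy bounds. -/
theorem accurate_of_dirac {X : Type*} {n k : ℕ} (hn : 0 < n) {ε τ : ℝ} (hε : 0 < ε)
    {N : Seminorm ℝ (Fin k → ℝ)} {q : X → Fin k → ℝ} (f : (Fin n → X) → Fin k → ℝ)
    (hf : ∀ x, N (f x - statQuery q x) ≤ τ) {M : Mechanism X n (Fin k → ℝ)}
    (hM : ∀ x, (M x).toMeasure = Measure.dirac (f x)) :
    (∀ x, expectedError N q M x ≤ ENNReal.ofReal τ) ∧
      ∀ x, ∀ β : ℝ, 0 < β →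
        (M x : Measure (Fin k → ℝ)).real
          {y | τ + 4 / (ε * n) * Real.log (1 / β) < N (y - statQuery q x)} ≤ β := by
  have hn0 : (0 : ℝ) < n := by exact_mod_cast hn
  refine ⟨fun x => ?_, fun x β hβ => ?_⟩
  · rw [expectedError, hM, lintegral_dirac' _ (N.measurable_sub_pi_fin _).ennreal_ofReal]
    exact ENNReal.ofReal_le_ofReal (hf x)
  · rcases le_total 1 β with h | h
    · exact measureReal_le_one.trans h
    · have h1 : 0 ≤ 4 / (ε * n) * Real.log (1 / β) :=
        mul_nonneg (by positivity) (Real.log_nonneg (by rwa [le_div_iff₀ hβ, one_mul]))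
      have h2 : f x ∉ {y | τ + 4 / (ε * n) * Real.log (1 / β) < N (y - statQuery q x)} := by
        simp only [Set.mem_ofPred_eq, not_lt]
        linarith [hf x]
      rw [hM, measureReal_def, Measure.dirac_apply' _
        (measurableSet_lt measurable_const (N.measurable_sub_pi_fin _)),
        Set.indicator_of_notMem h2]
      simpa using hβ.le

theorem statQuery_le_one {X : Type*} {n k : ℕ} (hn : 0 < n) {N : Seminorm ℝ (Fin k → ℝ)}
    {q : X → Fin k → ℝ} (hq : ∀ z, N (q z) ≤ 1) (x : Fin n → X) : N (statQuery q x) ≤ 1 := by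
  have hn0 : (0 : ℝ) < n := by exact_mod_cast hn
  rw [statQuery, map_smul_eq_mul, norm_inv, Real.norm_natCast, inv_mul_le_iff₀ hn0, mul_one]
  refine (Finset.le_sum_of_subadditive N (map_zero N).le (map_add_le_add N) _ _).trans ?_
  refine (Finset.sum_le_sum fun i _ => hq (x i)).trans ?_
  simp

theorem theorem7p1 {X : Type*} (n n' k : ℕ) (hn : 0 < n) (hn' : 0 < n')
    (α ε ξ ρ : ℝ) (hα : 0 < α) (hε : 0 < ε)
    (N : Seminorm ℝ (Fin k → ℝ)) (hN : ∀ v, N v = 0 → v = 0)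
    (q : X → Fin k → ℝ) (hq : ∀ z, N (q z) ≤ 1)
    (hM : ∃ M : Mechanism X n (Fin k → ℝ), IsZCDP ξ ρ M ∧
      ∀ x, expectedError N q M x ≤ ENNReal.ofReal α)
    (hξ : ξ ≤ α ^ 2) (hρ : ρ ≤ α ^ 2)
    (hsize : 4 / (ε * α) * (ρ * (n : ℝ) ^ 2 + ξ * n * (1 + Real.log n) + 1) ≤ (n' : ℝ)) :
    ∃ M' : Mechanism X n' (Fin k → ℝ), IsDP ε 0 M' ∧
      (∀ x, expectedError N q M' x ≤ ENNReal.ofReal (10 * α)) ∧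
      ∀ x, ∀ β : ℝ, 0 < β →
        (M' x : Measure (Fin k → ℝ)).real
          {y | 10 * α + 4 / (ε * n') * Real.log (1 / β) < N (y - statQuery q x)} ≤ β := by
  obtain ⟨M, hM, herr⟩ := hM
  -- over a trivial universe there are no neighbouring datasets: release the exact answer
  rcases subsingleton_or_nontrivial X with hX | hX
  · refine ⟨fun x => ⟨Measure.dirac (statQuery q x), inferInstance⟩, ?_,
      accurate_of_dirac hn' hε (statQuery q) (fun x => ?_) fun x => rfl⟩
    · rintro x x' ⟨i, hi, -⟩
      exact absurd (Subsingleton.elim _ _) hi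
    · rw [sub_self, map_zero]
      positivity
  -- for large `α` the constant answer `0` is accurate enough
  rcases le_total (1 / 10) α with hα1 | hα1
  · refine ⟨fun _ => ⟨Measure.dirac 0, inferInstance⟩, isDP_zero_of_const hε.le _,
      accurate_of_dirac hn' hε (fun _ => 0) (fun x => ?_) fun x => rfl⟩
    rw [zero_sub, map_neg_eq_map]
    linarith [statQuery_le_one hn' hq x]
  have hnonneg : ∀ a : ℝ, 1 < a → 0 ≤ ξ + ρ * a := fun a ha => hM.nonneg hn ha
  have h2 : 0 ≤ ξ + 2 * ρ := by linarith [hnonneg 2 (by norm_num)]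
  have hα2 : α ^ 2 ≤ 1 / 100 := by nlinarith
  have hn0' : (0 : ℝ) < n' := by exact_mod_cast hn'
  obtain ⟨T, hT, hTcard, hTnet⟩ := hM.exists_net hn hα herr
  set B := ρ * (n : ℝ) ^ 2 + ξ * n * (1 + Real.log n) + 1
  have hη : 0 < ε * n' / 4 := by positivity
  have hBη : B ≤ α * (ε * n' / 4) := by
    rw [div_mul_eq_mul_div, div_le_iff₀ (by positivity)] at hsize
    linarith
  -- the budget `10 * α` is split between the net error and the entropy of the net
  have hbudget : ∃ e s : ℝ, e + s ≤ 10 ∧ 0 ≤ s ∧ Real.log T.card ≤ s * B ∧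
      ∀ x : Fin n' → X, ∃ x₁ : Fin n → X,
        N (statQuery q x₁ - statQuery q x) ≤ (e - 4) * α := by
    rcases le_total 0 ξ with hξ0 | hξ0
    · refine ⟨8, 2, by norm_num, by norm_num, hTcard.trans (group_privacy_le_of_nonneg hξ0),
        fun x => ?_⟩
      obtain ⟨s, hs⟩ := hM.exists_subsample hn hn' hα hq herr (c := 2 * α) (δ := α / 10)
        (by positivity) (by positivity) x
      refine ⟨x ∘ s, hs.trans ?_⟩
      have he := exp_sub_one_le_of_le h2 (b := 3 * α ^ 2) (by linarith) (by linarith)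
      have : (Real.exp (ξ + 2 * ρ) - 1) / (2 * (2 * α)) ≤ 9 / 10 * α := by
        rw [div_le_iff₀ (by positivity)]
        nlinarith
      linarith
    · have hξρ : 0 ≤ ξ + ρ := by
        refine ge_of_tendsto (x := nhdsWithin 1 (Set.Ioi 1)) (f := fun a : ℝ => ξ + ρ * a) ?_ ?_
        · refine Filter.Tendsto.mono_left ?_ nhdsWithin_le_nhds
          have : Continuous fun a : ℝ => ξ + ρ * a := by fun_prop
          simpa using this.tendsto 1
        · filter_upwards [self_mem_nhdsWithin] with a ha
          exact hnonneg a ha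
      refine ⟨15 / 2, 5 / 2, by norm_num, by norm_num,
        hTcard.trans (group_privacy_le_of_neg hn hξ0 hξρ (by linarith)), fun x => ?_⟩
      obtain ⟨s, hs⟩ := hM.exists_subsample hn hn' hα hq herr (c := 3 / 2 * α) (δ := α / 20)
        (by positivity) (by positivity) x
      refine ⟨x ∘ s, hs.trans ?_⟩
      have he := exp_sub_one_le_of_le h2 (b := 2 * α ^ 2) (by linarith) (by linarith)
      have : (Real.exp (ξ + 2 * ρ) - 1) / (2 * (3 / 2 * α)) ≤ 7 / 10 * α := by
        rw [div_le_iff₀ (by positivity)]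
        nlinarith
      linarith
  obtain ⟨e, s, hes, hs0, hcard, hsub⟩ := hbudget
  refine exists_isDP_of_net hn' hε hq hT (statQuery q) fun x => ?_
  obtain ⟨x₁, hx₁⟩ := hsub x
  obtain ⟨t, ht, htx⟩ := hTnet x₁
  refine ⟨t, ht, ?_⟩
  have h1 : N (statQuery q t - statQuery q x) ≤
      N (statQuery q t - statQuery q x₁) + N (statQuery q x₁ - statQuery q x) :=
    (map_add_le_add N _ _).trans' (le_of_eq (by congr 1; abel))
  have h3 : Real.log T.card / (ε * n' / 4) ≤ s * α := by
    rw [div_le_iff₀ hη]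
    have := mul_le_mul_of_nonneg_left hBη hs0
    linarith
  have h4 := mul_le_mul_of_nonneg_right hes hα.le
  linarith
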